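/- Let $\phi:\mathbb{R}_+\to\mathbb{R}_+$ be continuous and concave with $\phi(0)=0$, differentiable on $(0,\infty)$, and such that the limit $\ell:=\lim_{s\downarrow 0}\phi'(s)$ exists in $\mathbb{R}$. Let $Y\in\mathbb{R}^{n\times p}$, let $\mathcal{M}=\{x\in\mathbb{R}^n:\|x\|=1\}$ be the Euclidean unit sphere, let $\delta_{\mathcal M}$ be its indicator function ($0$ on $\mathcal M$, $+\infty$ elsewhere), and let $|y|$ denote the vector of entrywise absolute values of $y$. Define $$F(x)=\sum_{i=1}^p\phi\big(|[Y^Tx]_i|\big)+\delta_{\mathcal M}(x),\qquad x\in\mathbb{R}^n,$$ $$\widetilde F(x,u)=\sum_{i=1}^p\psi^*(-u_i)+\langle u,|Y^Tx|\rangle+\delta_{\mathcal M}(x),\qquad (x,u)\in\mathbb{R}^n\times\mathbb{R}^p,$$ where $\psi(s)=-\phi(s)$ for $s\ge 0$, $\psi(s)=s^2-\ell s$ for $s<0$, and $\psi^*(w)=\sup_{s\in\mathbb{R}}\{ws-\psi(s)\}$. For a function $h:\mathbb{R}^m\to(-\infty,\infty]$, the regular subdifferential $\widehat\partial h(\bar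 x)$ at a point $\bar x$ with $h(\bar x)<\infty$ is the set of $v$ with $$\liminf_{x\to\bar x,\,x\ne\bar x}\frac{h(x)-h(\bar x)-\langle v,x-\bar x\rangle}{\|x-\bar x\|}\ge 0,$$ and the limiting subdifferential $\partial h(\bar x)$ is the set of limits of sequences $v^k\in\widehat\partial h(x^k)$ with $x^k\to\bar x$ and $h(x^k)\to h(\bar x)$; both are empty where $h=\infty$. For $\alpha\in[0,1)$, $h$ is called a KL function with exponent $\alpha$ if it is proper and lower semicontinuous and, for every $\hat x$ with $\partial h(\hat x)\neq\emptyset$, there are $a_0>0$, $a\in(0,\infty]$ and a neighborhood $V$ of $\hat x$ such that, with $\varphi(\nu)=a_0\nu^{1-\alpha}$, $$\varphi'\big(h(x)-h(\hat x)\big)\,\mathrm{dist}\big(0,\partial h(x)\big)\ge 1\quad\text{for all }x\in V\text{ with }h(\hat x)<h(x)<h(\hat x)+a,$$ where $\mathrm{dist}(0,\emptyset)=\infty$. **Theorem.** Let $\alpha\in[0,1)$. If $\widetilde F$ is a KL function with exponent $\alpha$, then $F$ is a KL function with exponent $\alpha$. -/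

import Mathlib

open Filter Topology
open scoped Matrix

noncomputable section

section VariationalAnalysis

variable {E : Type*} [NormedAddCommGroup E] [InnerProductSpace ℝ E]

/-- An extended-real-valued function is proper and closed: it never takes the value `-∞`,
it is finite at some point, and it is lower semicontinuous. -/
def ProperClosed (h : E → EReal) : Prop :=
  (∀ x, h x ≠ ⊥) ∧ (∃ x, h x ≠ ⊤) ∧ LowerSemicontinuous h

/-- The indicator function `δ_C`: it is `0` on `C` and `+∞` off `C`. -/
def indicatorFn (C : Set E) (x : E) : EReal :=
  open Classical in if x ∈ C then 0 else ⊤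

/-- The regular subdifferential `∂̂h(x₀)`; empty off the domain of `h`. -/
def regularSubdiff (h : E → EReal) (x₀ : E) : Set E :=
  {v | h x₀ < ⊤ ∧
    0 ≤ liminf (fun x => (h x - h x₀ - ((inner ℝ v (x - x₀) : ℝ) : EReal)) /
      ((‖x - x₀‖ : ℝ) : EReal)) (𝓝[≠] x₀)}

/-- The limiting subdifferential `∂h(x₀)`; empty off the domain of `h`. -/
def limitingSubdiff (h : E → EReal) (x₀ : E) : Set E :=
  {v | h x₀ < ⊤ ∧ ∃ (x : ℕ → E) (w : ℕ → E),
    Tendsto x atTop (𝓝 x₀) ∧ Tendsto (fun k => h (x k)) atTop (𝓝 (h x₀)) ∧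
    (∀ k, w k ∈ regularSubdiff h (x k)) ∧ Tendsto w atTop (𝓝 v)}

/-- `dom ∂h`: the points at which the limiting subdifferential is nonempty. -/
def domSubdiff (h : E → EReal) : Set E :=
  {x | (limitingSubdiff h x).Nonempty}

/-- For `a ∈ (0, ∞]`, `θ : [0, a) → [0, ∞)` is continuous and concave, `θ 0 = 0`, and `θ` is
continuously differentiable on `(0, a)` with positive derivative. -/
def IsDesingularizing (a : EReal) (θ : ℝ → ℝ) : Prop :=
  (∀ s : ℝ, 0 ≤ s → (s : EReal) < a → 0 ≤ θ s) ∧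
  ContinuousOn θ {s : ℝ | 0 ≤ s ∧ (s : EReal) < a} ∧
  ConcaveOn ℝ {s : ℝ | 0 ≤ s ∧ (s : EReal) < a} θ ∧
  θ 0 = 0 ∧
  ContDiffOn ℝ 1 θ {s : ℝ | 0 < s ∧ (s : EReal) < a} ∧
  ∀ s : ℝ, 0 < s → (s : EReal) < a → 0 < deriv θ s

/-- `h` satisfies the Kurdyka–Łojasiewicz property at `x₀` with the function `θ`. The distance
`dist(0, ∂h(x))` is taken in `[0, ∞]`, so that it is `∞` when `∂h(x)` is empty. -/
def KLAtWith (h : E → EReal) (x₀ : E) (θ : ℝ → ℝ) : Prop :=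
  ∃ a : EReal, 0 < a ∧ ∃ V ∈ 𝓝 x₀, IsDesingularizing a θ ∧
    ∀ x ∈ V, h x₀ < h x → h x < h x₀ + a →
      1 ≤ ENNReal.ofReal (deriv θ (h x - h x₀).toReal) *
        Metric.infEDist 0 (limitingSubdiff h x)

/-- `h` satisfies the KL property at `x₀` with exponent `α`: the function `θ` can be chosen as
`θ(ν) = a₀ ν ^ (1 - α)` for some `a₀ > 0`. -/
def KLAtWithExponent (h : E → EReal) (x₀ : E) (α : ℝ) : Prop :=
  ∃ a₀ : ℝ, 0 < a₀ ∧ KLAtWith h x₀ (fun ν => a₀ * ν ^ (1 - α))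

/-- `h` is a KL function with exponent `α` (used for `α ∈ [0, 1)`). -/
def IsKLFunctionWithExponent (h : E → EReal) (α : ℝ) : Prop :=
  ProperClosed h ∧ ∀ x₀ ∈ domSubdiff h, KLAtWithExponent h x₀ α

end VariationalAnalysis

section Potentials

/-- The vector `|Yᵀ x| ∈ ℝᵖ` of entrywise absolute values. -/
def absYT {n p : ℕ} (Y : Matrix (Fin n) (Fin p) ℝ) (x : EuclideanSpace ℝ (Fin n)) :
    EuclideanSpace ℝ (Fin p) :=
  WithLp.toLp 2 fun i => |(Yᵀ *ᵥ WithLp.ofLp x) i|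

/-- The unit sphere `𝓜` of `ℝⁿ`. -/
def unitSphere (n : ℕ) : Set (EuclideanSpace ℝ (Fin n)) :=
  {x | ‖x‖ = 1}

/-- `F(x) = ∑ᵢ φ(|[Yᵀ x]ᵢ|) + δ_𝓜(x)`. -/
def potF {n p : ℕ} (φ : ℝ → ℝ) (Y : Matrix (Fin n) (Fin p) ℝ)
    (x : EuclideanSpace ℝ (Fin n)) : EReal :=
  ((∑ i, φ (absYT Y x i) : ℝ) : EReal) + indicatorFn (unitSphere n) x

/-- `ψ(s) = -φ(s)` for `s ≥ 0`, and `ψ(s) = s² - ℓ s` for `s < 0`. -/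
def psi (φ : ℝ → ℝ) (ℓ : ℝ) (s : ℝ) : ℝ :=
  if 0 ≤ s then -φ s else s ^ 2 - ℓ * s

/-- The Fenchel conjugate `g*(w) = sup_s (w s - g(s))` of a function on the real line. -/
def fenchelConj (g : ℝ → ℝ) (w : ℝ) : EReal :=
  ⨆ s : ℝ, ((w * s - g s : ℝ) : EReal)

/-- `Ψ*(w) = ∑ᵢ ψ*(wᵢ)`. -/
def PsiStar {p : ℕ} (φ : ℝ → ℝ) (ℓ : ℝ) (w : EuclideanSpace ℝ (Fin p)) : EReal :=
  ∑ i, fenchelConj (psi φ ℓ) (w i)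

/-- `F̃(x, u) = Ψ*(-u) + ⟨u, |Yᵀ x|⟩ + δ_𝓜(x)` on `ℝⁿ × ℝᵖ` with its Euclidean structure. -/
def potFtilde {n p : ℕ} (φ : ℝ → ℝ) (ℓ : ℝ) (Y : Matrix (Fin n) (Fin p) ℝ)
    (z : WithLp 2 (EuclideanSpace ℝ (Fin n) × EuclideanSpace ℝ (Fin p))) : EReal :=
  PsiStar φ ℓ (-z.snd) + ((inner ℝ z.snd (absYT Y z.fst) : ℝ) : EReal) +
    indicatorFn (unitSphere n) z.fst

end Potentials

end

/-!
The function `F` is the partial infimum of `F̃` over `u`: by the Fenchel–Young inequality for `ψ`,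
`F x ≤ F̃ (x, u)` for all `u`, and the infimum is attained at `u = φ'(|Yᵀ x|)` (entrywise, with
`φ'(0) = ℓ`). A differentiable concave function has a continuous derivative, so this minimizer
`u(x)` depends continuously on `x`.

An inf-projection with a continuous selection of minimizers inherits the KL exponent. Indeed
`F̃ (x', u') - F̃ (x, u(x)) ≥ F x' - F x`, so `v ∈ ∂̂F(x)` gives `(v, 0) ∈ ∂̂F̃(x, u(x))`; by
continuity of `u` the same holds for the limiting subdifferentials. Hence
`dist(0, ∂F(x)) ≥ dist(0, ∂F̃(x, u(x)))`, and the KL inequality of `F̃` at `(x₀, u(x₀))`, restricted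
to the graph of `u`, is the one for `F` at `x₀`, with the same desingularizing function
(`IsKLFunctionWithExponent.of_continuous_selection`).
-/

/-! ### Inf-projections with a continuous selection of minimizers -/

section InfProjection

theorem continuous_toLp_graph {E E' : Type*} [TopologicalSpace E]
    [TopologicalSpace E'] {u : E → E'} (hu : Continuous u) :
    Continuous fun x => (WithLp.toLp 2 (x, u x) : WithLp 2 (E × E')) :=
  (WithLp.prod_continuous_toLp 2 E E').comp (continuous_id.prodMk hu)

variable {E E' : Type*} [NormedAddCommGroup E] [InnerProductSpace ℝ E]
  [NormedAddCommGroup E'] [InnerProductSpace ℝ E']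
  {f : E → EReal} {G : WithLp 2 (E × E') → EReal} {u : E → E'}

theorem regularSubdiff_of_selection (hbot : ∀ x, f x ≠ ⊥) (hle : ∀ z, f z.fst ≤ G z)
    (heq : ∀ x, G (WithLp.toLp 2 (x, u x)) = f x) {x₀ v : E} (hv : v ∈ regularSubdiff f x₀) :
    WithLp.toLp 2 (v, (0 : E')) ∈ regularSubdiff G (WithLp.toLp 2 (x₀, u x₀)) := by
  obtain ⟨hfin, hlim⟩ := hv
  refine ⟨by rwa [heq], ?_⟩
  rw [heq]
  obtain ⟨a, ha⟩ : ∃ a : ℝ, f x₀ = a :=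
    ⟨(f x₀).toReal, (EReal.coe_toReal hfin.ne (hbot x₀)).symm⟩
  rw [ha] at hlim ⊢
  rw [le_liminf_iff] at hlim ⊢
  intro c hc
  obtain ⟨r, hcr, hr⟩ := EReal.lt_iff_exists_real_btwn.1 hc
  have hr0 : r < 0 := by exact_mod_cast hr
  have hev := eventually_nhdsWithin_iff.1 (hlim r hr)
  have hfst : Tendsto (fun z : WithLp 2 (E × E') => z.fst) (𝓝[≠] WithLp.toLp 2 (x₀, u x₀))
      (𝓝 x₀) :=
    ((WithLp.continuous_fst 2 E E').tendsto _).mono_left nhdsWithin_le_nhds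
  filter_upwards [hfst.eventually hev, self_mem_nhdsWithin] with z hz hne
  set d : ℝ := ‖z - WithLp.toLp 2 (x₀, u x₀)‖ with hd
  have hdpos : 0 < d := norm_pos_iff.2 (sub_ne_zero.2 hne)
  have hdle : ‖z.fst - x₀‖ ≤ d := by
    have := WithLp.norm_fst_le E (z - WithLp.toLp 2 (x₀, u x₀))
    simpa using this
  have hin : inner ℝ (WithLp.toLp 2 (v, (0 : E'))) (z - WithLp.toLp 2 (x₀, u x₀))
      = inner ℝ v (z.fst - x₀) := by
    simp [WithLp.prod_inner_apply]
  rw [hin]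
  refine hcr.trans_le ?_
  rw [EReal.le_div_iff_mul_le (by exact_mod_cast hdpos) (EReal.coe_ne_top _)]
  -- The growth bound on `f` also holds at `z.fst = x₀`, which the punctured neighbourhood omits.
  have key : ((r * ‖z.fst - x₀‖ : ℝ) : EReal) ≤
      f z.fst - (a : EReal) - ((inner ℝ v (z.fst - x₀) : ℝ) : EReal) := by
    by_cases hx : z.fst = x₀
    · rw [hx, ha, sub_self]
      norm_cast
      simp
    · have h := (hz hx).le
      rw [EReal.le_div_iff_mul_le (by exact_mod_cast norm_pos_iff.2 (sub_ne_zero.2 hx))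
        (EReal.coe_ne_top _)] at h
      exact_mod_cast h
  calc (r : EReal) * (d : EReal) = ((r * d : ℝ) : EReal) := by norm_cast
    _ ≤ ((r * ‖z.fst - x₀‖ : ℝ) : EReal) :=
        EReal.coe_le_coe_iff.2 (mul_le_mul_of_nonpos_left hdle hr0.le)
    _ ≤ _ := key
    _ ≤ _ := EReal.sub_le_sub (EReal.sub_le_sub (hle z) le_rfl) le_rfl

theorem limitingSubdiff_of_selection (hbot : ∀ x, f x ≠ ⊥) (hle : ∀ z, f z.fst ≤ G z)
    (heq : ∀ x, G (WithLp.toLp 2 (x, u x)) = f x) (hu : Continuous u) {x₀ v : E}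
    (hv : v ∈ limitingSubdiff f x₀) :
    WithLp.toLp 2 (v, (0 : E')) ∈ limitingSubdiff G (WithLp.toLp 2 (x₀, u x₀)) := by
  obtain ⟨hfin, x, w, hx, hfx, hw, hwv⟩ := hv
  refine ⟨by rwa [heq], fun k => WithLp.toLp 2 (x k, u (x k)), fun k => WithLp.toLp 2 (w k, 0),
    ((continuous_toLp_graph hu).tendsto x₀).comp hx, by simpa only [heq] using hfx,
    fun k => regularSubdiff_of_selection hbot hle heq (hw k),
    ((continuous_toLp_graph (E' := E') continuous_const).tendsto v).comp hwv⟩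

theorem infEDist_limitingSubdiff_le_of_selection (hbot : ∀ x, f x ≠ ⊥)
    (hle : ∀ z, f z.fst ≤ G z) (heq : ∀ x, G (WithLp.toLp 2 (x, u x)) = f x)
    (hu : Continuous u) (x : E) :
    Metric.infEDist 0 (limitingSubdiff G (WithLp.toLp 2 (x, u x))) ≤
      Metric.infEDist 0 (limitingSubdiff f x) := by
  refine Metric.le_infEDist.2 fun v hv => ?_
  refine (Metric.infEDist_le_edist_of_mem
    (limitingSubdiff_of_selection hbot hle heq hu hv)).trans_eq ?_
  rw [edist_zero_left, edist_zero_left]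
  simp

/-- If `f` is the partial infimum of `G` and the infimum is attained along a continuous selection
`u`, then `f` inherits from `G` the KL exponent. -/
theorem IsKLFunctionWithExponent.of_continuous_selection {α : ℝ} (hf : ProperClosed f)
    (hle : ∀ z, f z.fst ≤ G z) (heq : ∀ x, G (WithLp.toLp 2 (x, u x)) = f x)
    (hu : Continuous u) (hG : IsKLFunctionWithExponent G α) :
    IsKLFunctionWithExponent f α := by
  refine ⟨hf, fun x₀ ⟨v, hv⟩ => ?_⟩
  obtain ⟨a₀, ha₀, a, ha, V, hV, hθ, hKL⟩ :=
    hG.2 _ ⟨_, limitingSubdiff_of_selection hf.1 hle heq hu hv⟩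
  refine ⟨a₀, ha₀, a, ha, _, (continuous_toLp_graph hu).tendsto x₀ hV, hθ, fun x hx h₁ h₂ => ?_⟩
  have h := hKL _ hx (by simpa only [heq] using h₁) (by simpa only [heq] using h₂)
  simp only [heq] at h
  exact h.trans (mul_le_mul_right
    (infEDist_limitingSubdiff_le_of_selection hf.1 hle heq hu x) _)

end InfProjection

/-! ### Concave functions on the half-line and their slopes -/

section Concave

/-- The derivative of `φ` on `(0, ∞)`, extended by the constant `ℓ` to `(-∞, 0]`. -/
noncomputable def extendedDeriv (φ : ℝ → ℝ) (ℓ : ℝ) (s : ℝ) : ℝ :=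
  if 0 < s then deriv φ s else ℓ

variable {φ : ℝ → ℝ} {ℓ : ℝ}

theorem ConcaveOn.antitoneOn_deriv_Ioi (hconc : ConcaveOn ℝ (Set.Ici 0) φ)
    (hdiff : ∀ s : ℝ, 0 < s → DifferentiableAt ℝ φ s) : AntitoneOn (deriv φ) (Set.Ioi 0) :=
  (hconc.subset Set.Ioi_subset_Ici_self (convex_Ioi 0)).antitoneOn_deriv hdiff

/-- The one-sided limits of the monotone function `deriv φ` at `s` are one-sided derivatives of
`φ`, so both equal `deriv φ s`. -/
theorem ConcaveOn.continuousAt_deriv (hconc : ConcaveOn ℝ (Set.Ici 0) φ)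
    (hdiff : ∀ s : ℝ, 0 < s → DifferentiableAt ℝ φ s) {s : ℝ} (hs : 0 < s) :
    ContinuousAt (deriv φ) s := by
  have hanti := hconc.antitoneOn_deriv_Ioi hdiff
  have hdiffOn : ∀ t : Set ℝ, t ⊆ Set.Ioi 0 → DifferentiableOn ℝ φ t :=
    fun t ht x hx => (hdiff x (ht hx)).differentiableWithinAt
  have hcont (t : Set ℝ) : ContinuousWithinAt φ t s := (hdiff s hs).continuousAt.continuousWithinAt
  have hleft : Set.Ioo (s / 2) s ⊆ Set.Ioi 0 := fun x hx => (half_pos hs).trans hx.1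
  have hright : Set.Ioo s (s + 1) ⊆ Set.Ioi 0 := fun x hx => hs.trans hx.1
  rw [continuousAt_iff_continuous_left'_right']
  constructor
  · have hlim := (hanti.mono hleft).tendsto_nhdsWithin_Ioo_left
      (Set.nonempty_Ioo.2 (half_lt_self hs))
      ⟨deriv φ s, by rintro _ ⟨x, hx, rfl⟩; exact hanti (hleft hx) hs hx.2.le⟩
    have hder := hasDerivWithinAt_Iic_of_tendsto_deriv (hdiffOn _ hleft) (hcont _)
      (Ioo_mem_nhdsLT (half_lt_self hs)) hlim
    have := (uniqueDiffWithinAt_Iic s).eq_deriv _ hder (hdiff s hs).hasDerivAt.hasDerivWithinAt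
    rwa [this] at hlim
  · have hlim := (hanti.mono hright).tendsto_nhdsWithin_Ioo_right
      (Set.nonempty_Ioo.2 (lt_add_one s))
      ⟨deriv φ s, by rintro _ ⟨x, hx, rfl⟩; exact hanti hs (hright hx) hx.1.le⟩
    have hder := hasDerivWithinAt_Ici_of_tendsto_deriv (hdiffOn _ hright) (hcont _)
      (Ioo_mem_nhdsGT (lt_add_one s)) hlim
    have := (uniqueDiffWithinAt_Ici s).eq_deriv _ hder (hdiff s hs).hasDerivAt.hasDerivWithinAt
    rwa [this] at hlim

theorem continuous_extendedDeriv (hconc : ConcaveOn ℝ (Set.Ici 0) φ)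
    (hdiff : ∀ s : ℝ, 0 < s → DifferentiableAt ℝ φ s)
    (hℓ : Tendsto (deriv φ) (𝓝[>] 0) (𝓝 ℓ)) : Continuous (extendedDeriv φ ℓ) := by
  rw [continuous_iff_continuousAt]
  intro s
  rcases lt_trichotomy s 0 with hs | rfl | hs
  · refine (continuousAt_const (y := ℓ)).congr ?_
    filter_upwards [Iio_mem_nhds hs] with t ht
    simp [extendedDeriv, not_lt.2 (Set.mem_Iio.1 ht).le]
  · rw [continuousAt_iff_continuous_left'_right']
    have h0 : extendedDeriv φ ℓ 0 = ℓ := by simp [extendedDeriv]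
    constructor
    · refine (tendsto_const_nhds (x := ℓ)).congr' ?_ |>.trans (by rw [h0])
      filter_upwards [self_mem_nhdsWithin] with t ht
      simp [extendedDeriv, not_lt.2 (Set.mem_Iio.1 ht).le]
    · refine hℓ.congr' ?_ |>.trans (by rw [h0])
      filter_upwards [self_mem_nhdsWithin] with t ht
      simp [extendedDeriv, Set.mem_Ioi.1 ht]
  · refine (hconc.continuousAt_deriv hdiff hs).congr ?_
    filter_upwards [Ioi_mem_nhds hs] with t ht
    simp [extendedDeriv, Set.mem_Ioi.1 ht]

theorem extendedDeriv_le (hconc : ConcaveOn ℝ (Set.Ici 0) φ)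
    (hdiff : ∀ s : ℝ, 0 < s → DifferentiableAt ℝ φ s)
    (hℓ : Tendsto (deriv φ) (𝓝[>] 0) (𝓝 ℓ)) (s : ℝ) : extendedDeriv φ ℓ s ≤ ℓ := by
  unfold extendedDeriv
  split_ifs with hs
  · refine ge_of_tendsto hℓ ?_
    filter_upwards [Ioo_mem_nhdsGT hs] with t ht
    exact hconc.antitoneOn_deriv_Ioi hdiff ht.1 hs ht.2.le
  · exact le_rfl

theorem ConcaveOn.le_tangent (hconc : ConcaveOn ℝ (Set.Ici 0) φ)
    (hdiff : ∀ s : ℝ, 0 < s → DifferentiableAt ℝ φ s) {s t : ℝ} (hs : 0 < s) (ht : 0 ≤ t) :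
    φ t ≤ φ s + deriv φ s * (t - s) := by
  rcases lt_trichotomy s t with h | rfl | h
  · have := hconc.slope_le_deriv hs.le ht h (hdiff s hs)
    rw [slope_def_field, div_le_iff₀ (sub_pos.2 h)] at this
    linarith
  · simp
  · have := hconc.deriv_le_slope ht hs.le h (hdiff s hs)
    rw [slope_def_field, le_div_iff₀ (sub_pos.2 h)] at this
    linarith

theorem le_tangent_extendedDeriv (hcont : ContinuousOn φ (Set.Ici 0))
    (hconc : ConcaveOn ℝ (Set.Ici 0) φ) (hdiff : ∀ s : ℝ, 0 < s → DifferentiableAt ℝ φ s)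
    (hℓ : Tendsto (deriv φ) (𝓝[>] 0) (𝓝 ℓ)) {s t : ℝ} (hs : 0 ≤ s) (ht : 0 ≤ t) :
    φ t ≤ φ s + extendedDeriv φ ℓ s * (t - s) := by
  rcases hs.eq_or_lt with rfl | hs
  · -- The tangent inequality at `0` is the limit of those at `r ↓ 0`.
    have hφ : Tendsto φ (𝓝[>] 0) (𝓝 (φ 0)) :=
      (hcont 0 Set.self_mem_Ici).mono_left (nhdsWithin_mono _ Set.Ioi_subset_Ici_self)
    have hid : Tendsto (fun r : ℝ => t - r) (𝓝[>] 0) (𝓝 (t - 0)) :=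
      (tendsto_const_nhds.sub tendsto_id).mono_left nhdsWithin_le_nhds
    have h0 : extendedDeriv φ ℓ 0 = ℓ := by simp [extendedDeriv]
    rw [h0]
    refine ge_of_tendsto (hφ.add (hℓ.mul hid)) ?_
    filter_upwards [self_mem_nhdsWithin] with r hr
    exact hconc.le_tangent hdiff hr ht
  · simpa [extendedDeriv, hs] using hconc.le_tangent hdiff hs ht

/-- The convex function `ψ` lies above its tangent at `s ≥ 0`, of slope `-φ'(s)`; hence the
supremum defining `ψ*(-φ'(s))` is attained at `s`. -/
theorem fenchelConj_psi_neg_extendedDeriv (hcont : ContinuousOn φ (Set.Ici 0))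
    (hconc : ConcaveOn ℝ (Set.Ici 0) φ) (hzero : φ 0 = 0)
    (hdiff : ∀ s : ℝ, 0 < s → DifferentiableAt ℝ φ s)
    (hℓ : Tendsto (deriv φ) (𝓝[>] 0) (𝓝 ℓ)) {s : ℝ} (hs : 0 ≤ s) :
    fenchelConj (psi φ ℓ) (-extendedDeriv φ ℓ s) = ((φ s - extendedDeriv φ ℓ s * s : ℝ) : EReal) := by
  refine le_antisymm (iSup_le fun t => EReal.coe_le_coe_iff.2 ?_) ?_
  · unfold psi
    split_ifs with ht
    · linarith [le_tangent_extendedDeriv hcont hconc hdiff hℓ hs ht]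
    · have h0 := le_tangent_extendedDeriv hcont hconc hdiff hℓ hs le_rfl
      nlinarith [extendedDeriv_le hconc hdiff hℓ s, sq_nonneg t]
  · refine le_iSup_of_le s (EReal.coe_le_coe_iff.2 ?_)
    simp only [psi, hs, if_true]
    linarith

theorem le_fenchelConj_psi_neg {s : ℝ} (hs : 0 ≤ s) (w : ℝ) :
    ((φ s - w * s : ℝ) : EReal) ≤ fenchelConj (psi φ ℓ) (-w) := by
  refine le_iSup_of_le s (EReal.coe_le_coe_iff.2 ?_)
  simp only [psi, hs, if_true]
  linarith

end Concave

/-! ### The potentials on the sphere -/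

section Potentials

variable {n p : ℕ} {Y : Matrix (Fin n) (Fin p) ℝ} {φ : ℝ → ℝ} {ℓ : ℝ}

theorem absYT_nonneg (x : EuclideanSpace ℝ (Fin n)) (i : Fin p) : 0 ≤ absYT Y x i :=
  abs_nonneg _

theorem continuous_absYT : Continuous (absYT Y) := by
  refine (PiLp.continuous_toLp 2 _).comp (continuous_pi fun i => ?_)
  exact ((continuous_apply i).comp
    (continuous_const.matrix_mulVec (PiLp.continuous_ofLp 2 _))).abs

theorem indicatorFn_ne_bot {E : Type*} [NormedAddCommGroup E] (C : Set E)
    (x : E) : indicatorFn C x ≠ ⊥ := by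
  unfold indicatorFn
  split_ifs <;> simp

theorem lowerSemicontinuous_indicatorFn {E : Type*} [NormedAddCommGroup E]
    {C : Set E} (hC : IsClosed C) : LowerSemicontinuous (indicatorFn C) := by
  intro x c hc
  by_cases hx : x ∈ C
  · have hc0 : c < 0 := by simpa [indicatorFn, hx] using hc
    filter_upwards with y
    unfold indicatorFn
    split_ifs
    · exact hc0
    · exact hc0.trans (by simp)
  · filter_upwards [hC.isOpen_compl.mem_nhds hx] with y hy
    have hy' : y ∉ C := hy
    simpa [indicatorFn, hx, hy'] using hc

theorem potF_ne_bot (x : EuclideanSpace ℝ (Fin n)) : potF φ Y x ≠ ⊥ :=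
  EReal.add_ne_bot_iff.2 ⟨EReal.coe_ne_bot _, indicatorFn_ne_bot _ _⟩

theorem lowerSemicontinuous_potF (hcont : ContinuousOn φ (Set.Ici 0)) :
    LowerSemicontinuous (potF φ Y) := by
  have hreal : Continuous fun x : EuclideanSpace ℝ (Fin n) => ∑ i, φ (absYT Y x i) := by
    refine continuous_finsetSum _ fun i _ => hcont.comp_continuous ?_ fun x => absYT_nonneg x i
    exact (PiLp.continuous_apply 2 _ i).comp continuous_absYT
  refine (continuous_coe_real_ereal.comp hreal).lowerSemicontinuous.add'
    (lowerSemicontinuous_indicatorFn (isClosed_eq continuous_norm continuous_const)) fun x => ?_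
  exact EReal.continuousAt_add (Or.inl (EReal.coe_ne_top _)) (Or.inl (EReal.coe_ne_bot _))

theorem EReal.coe_finset_sum {ι : Type*} (s : Finset ι) (g : ι → ℝ) :
    ((∑ i ∈ s, g i : ℝ) : EReal) = ∑ i ∈ s, (g i : EReal) := by
  induction s using Finset.cons_induction with
  | empty => simp
  | cons a s ha ih => simp [Finset.sum_cons, ih]

theorem inner_absYT (x : EuclideanSpace ℝ (Fin n)) (w : EuclideanSpace ℝ (Fin p)) :
    (inner ℝ w (absYT Y x) : ℝ) = ∑ i, w i * absYT Y x i := by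
  simp [PiLp.inner_apply, mul_comm]

theorem sum_phi_eq (x : EuclideanSpace ℝ (Fin n)) (w : EuclideanSpace ℝ (Fin p)) :
    ((∑ i, φ (absYT Y x i) : ℝ) : EReal) =
      (∑ i, ((φ (absYT Y x i) - w i * absYT Y x i : ℝ) : EReal)) +
        ((inner ℝ w (absYT Y x) : ℝ) : EReal) := by
  rw [inner_absYT, ← EReal.coe_finset_sum, ← EReal.coe_add, ← Finset.sum_add_distrib]
  simp

theorem potF_le_potFtilde
    (z : WithLp 2 (EuclideanSpace ℝ (Fin n) × EuclideanSpace ℝ (Fin p))) :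
    potF φ Y z.fst ≤ potFtilde φ ℓ Y z := by
  unfold potF potFtilde PsiStar
  rw [sum_phi_eq z.fst z.snd]
  gcongr with i
  exact le_fenchelConj_psi_neg (absYT_nonneg _ _) _

/-- The minimizer of `F̃ (x, ·)`: the vector `φ'(|Yᵀ x|)`, where `φ'(0) = ℓ`. -/
noncomputable def dualSelection (φ : ℝ → ℝ) (ℓ : ℝ) (Y : Matrix (Fin n) (Fin p) ℝ)
    (x : EuclideanSpace ℝ (Fin n)) : EuclideanSpace ℝ (Fin p) :=
  WithLp.toLp 2 fun i => extendedDeriv φ ℓ (absYT Y x i)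

theorem continuous_dualSelection (hconc : ConcaveOn ℝ (Set.Ici 0) φ)
    (hdiff : ∀ s : ℝ, 0 < s → DifferentiableAt ℝ φ s)
    (hℓ : Tendsto (deriv φ) (𝓝[>] 0) (𝓝 ℓ)) : Continuous (dualSelection φ ℓ Y) :=
  (PiLp.continuous_toLp 2 _).comp (continuous_pi fun i =>
    (continuous_extendedDeriv hconc hdiff hℓ).comp
      ((PiLp.continuous_apply 2 _ i).comp continuous_absYT))

theorem potFtilde_dualSelection (hcont : ContinuousOn φ (Set.Ici 0))
    (hconc : ConcaveOn ℝ (Set.Ici 0) φ) (hzero : φ 0 = 0)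
    (hdiff : ∀ s : ℝ, 0 < s → DifferentiableAt ℝ φ s)
    (hℓ : Tendsto (deriv φ) (𝓝[>] 0) (𝓝 ℓ)) (x : EuclideanSpace ℝ (Fin n)) :
    potFtilde φ ℓ Y (WithLp.toLp 2 (x, dualSelection φ ℓ Y x)) = potF φ Y x := by
  unfold potF potFtilde PsiStar
  rw [sum_phi_eq x (dualSelection φ ℓ Y x)]
  congr 2
  exact Finset.sum_congr rfl fun i _ =>
    fenchelConj_psi_neg_extendedDeriv hcont hconc hzero hdiff hℓ (absYT_nonneg x i)

end Potentials

theorem theorem4p10 (n p : ℕ) (Y : Matrix (Fin n) (Fin p) ℝ) (φ : ℝ → ℝ) (ℓ : ℝ)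
    (hφ_nonneg : ∀ s : ℝ, 0 ≤ s → 0 ≤ φ s)
    (hφ_cont : ContinuousOn φ (Set.Ici 0))
    (hφ_conc : ConcaveOn ℝ (Set.Ici 0) φ)
    (hφ_zero : φ 0 = 0)
    (hφ_diff : ∀ s : ℝ, 0 < s → DifferentiableAt ℝ φ s)
    (hℓ : Tendsto (deriv φ) (𝓝[>] 0) (𝓝 ℓ))
    (α : ℝ) (hα0 : 0 ≤ α) (hα1 : α < 1)
    (hKL : IsKLFunctionWithExponent (potFtilde φ ℓ Y) α) :
    IsKLFunctionWithExponent (potF φ Y) α := by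
  -- A point where `F̃` is finite projects to one where `F` is, so properness passes to `F`.
  obtain ⟨z, hz⟩ := hKL.1.2.1
  exact IsKLFunctionWithExponent.of_continuous_selection
    ⟨potF_ne_bot, ⟨z.fst, ne_top_of_le_ne_top hz (potF_le_potFtilde z)⟩,
      lowerSemicontinuous_potF hφ_cont⟩
    potF_le_potFtilde (potFtilde_dualSelection hφ_cont hφ_conc hφ_zero hφ_diff hℓ)
    (continuous_dualSelection hφ_conc hφ_diff hℓ) hKL
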